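/- Let $\omega=(\omega_x)_{x\in\mathbb Z}\in\mathbb R^{\mathbb Z}$ be any fixed environment. For $x\in\mathbb Z$ let $$U_x=\frac1{\sqrt2}\begin{pmatrix}e^{i\omega_x}&1\\1&-e^{-i\omega_x}\end{pmatrix},$$ and let $P_x$ and $Q_x$ be the matrices obtained from $U_x$ by replacing, respectively, the lower row and the upper row by zeros. For $l,m\ge0$ and $n=l+m$, let $\Xi_n(l,m)$ be the sum, over all nearest-neighbour paths of $n$ steps in $\mathbb Z$ which start from $0$ and make $l$ steps to the left and $m$ steps to the right, of the products (latest step leftmost) of the matrices $P_x$ for each step from $x$ to $x-1$ and $Q_x$ for each step from $x$ to $x+1$. Let $\varphi_*={}^T[1/\sqrt2,\,i/\sqrt2]$. The quantum walk $X_n$ in the environment $\omega$ has the law $P_n^\omega$ on $\mathbb Z$ given by $$P_n^\omega(X_n=x)=\|\Xi_n(l,m)\varphi_*\|^2\qquad(n=l+m,\ x=-l+m),$$ all other points having probability $0$. Let $$f_K(x)=\frac{1}{\pi(1-x^2)\sqrt{1-2x^2}}\ \text{ for } |x|<\tfrac1{\sqrt2},\qquad f_K(x)=0\ \text{ otherwise.}$$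 Then $(1-\sin(\omega_0)\,x)f_K(x)$ is a probability density on $\mathbb R$, the law of $X_n/n$ under $P_n^\omega$ converges weakly, as $n\to\infty$, to the probability measure with this density, and for all real $u\le v$ $$\lim_{n\to\infty}P_n^\omega\Big(u\le\frac{X_n}{n}\le v\Big)=\int_u^v\{1-\sin(\omega_0)\,x\}\,f_K(x)\,dx .$$ In particular the limit depends on the environment only through $\omega_0$. -/

import Mathlib

open MeasureTheory Filter Topology

namespace QWRE

noncomputable section

/-- The coin at `x` in the environment `ω`. -/
def coin (ω : ℤ → ℝ) (x : ℤ) : Matrix (Fin 2) (Fin 2) ℂ :=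
  ((1 / Real.sqrt 2 : ℝ) : ℂ) •
    !![Complex.exp (Complex.I * (ω x : ℂ)), 1;
       1, -Complex.exp (-(Complex.I * (ω x : ℂ)))]

/-- `P_x`: the upper row of the coin at `x`; a move from `x` to the left. -/
def leftPart (ω : ℤ → ℝ) (x : ℤ) : Matrix (Fin 2) (Fin 2) ℂ :=
  !![coin ω x 0 0, coin ω x 0 1; 0, 0]

/-- `Q_x`: the lower row of the coin at `x`; a move from `x` to the right. -/
def rightPart (ω : ℤ → ℝ) (x : ℤ) : Matrix (Fin 2) (Fin 2) ℂ :=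
  !![0, 0; coin ω x 1 0, coin ω x 1 1]

/-- A path of `n` steps is a function `Fin n → Bool`, `true` for a step to the right and `false`
for a step to the left. Number of left steps. -/
def numLeft {n : ℕ} (s : Fin n → Bool) : ℕ := ∑ j, if s j then 0 else 1

/-- Number of right steps of a path. -/
def numRight {n : ℕ} (s : Fin n → Bool) : ℕ := ∑ j, if s j then 1 else 0

/-- End point of a path that starts from the origin. -/
def endPoint {n : ℕ} (s : Fin n → Bool) : ℤ := ∑ j, if s j then 1 else -1

/-- The time-ordered product, latest step leftmost, of the matrices `P_x`, `Q_x` met along a path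
from the origin, where `x` is the position from which the step is made. -/
def pathMatrix (ω : ℤ → ℝ) : (n : ℕ) → (Fin n → Bool) → Matrix (Fin 2) (Fin 2) ℂ
  | 0, _ => 1
  | n + 1, s =>
    (if s (Fin.last n) then rightPart ω (endPoint (Fin.init s))
      else leftPart ω (endPoint (Fin.init s))) * pathMatrix ω n (Fin.init s)

/-- `Ξ_n(l, m)`: the sum over all paths of `n` steps from the origin with `l` steps to the left
and `m` steps to the right. -/
def pathSum (ω : ℤ → ℝ) (n l m : ℕ) : Matrix (Fin 2) (Fin 2) ℂ :=
  ∑ s : Fin n → Bool with numLeft s = l ∧ numRight s = m, pathMatrix ω n s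

/-- The initial qubit state `ᵀ[1/√2, i/√2]`. -/
def initialState : Fin 2 → ℂ :=
  ![((1 / Real.sqrt 2 : ℝ) : ℂ), Complex.I * ((1 / Real.sqrt 2 : ℝ) : ℂ)]

/-- `‖Ξ_n(l, m) φ‖²` with the Euclidean norm of `ℂ²`. -/
def weight (ω : ℤ → ℝ) (n l m : ℕ) : ℝ :=
  ‖WithLp.toLp 2 ((pathSum ω n l m).mulVec initialState)‖ ^ 2

/-- The quenched law of `X_n` on `ℤ`: mass `‖Ξ_n(l, m) φ‖²` at `x = -l + m` for `l + m = n`. -/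
def walkLaw (ω : ℤ → ℝ) (n : ℕ) : Measure ℤ :=
  ∑ p ∈ Finset.HasAntidiagonal.antidiagonal n,
    ENNReal.ofReal (weight ω n p.1 p.2) • Measure.dirac (-(p.1 : ℤ) + (p.2 : ℤ))

lemma numLeft_snoc {n : ℕ} (s : Fin n → Bool) (b : Bool) :
    numLeft (Fin.snoc s b : Fin (n + 1) → Bool) = numLeft s + if b then 0 else 1 := by
  simp [numLeft, Fin.sum_univ_castSucc]

lemma numRight_snoc {n : ℕ} (s : Fin n → Bool) (b : Bool) :
    numRight (Fin.snoc s b : Fin (n + 1) → Bool) = numRight s + if b then 1 else 0 := by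
  simp only [numRight, Fin.sum_univ_castSucc, Fin.snoc_castSucc, Fin.snoc_last]

lemma endPoint_eq {n : ℕ} (s : Fin n → Bool) :
    endPoint s = -(numLeft s : ℤ) + (numRight s : ℤ) := by
  simp only [endPoint, numLeft, numRight]
  push_cast
  rw [← Finset.sum_neg_distrib, ← Finset.sum_add_distrib]
  refine Finset.sum_congr rfl fun j _ => ?_
  cases s j <;> simp

/-- The last step of a path is a step to the left or a step to the right. -/
lemma pathSum_succ (ω : ℤ → ℝ) (n l m : ℕ) :
    pathSum ω (n + 1) l m =
      (if l = 0 then 0 else leftPart ω (-(l : ℤ) + m + 1) * pathSum ω n (l - 1) m) +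
      (if m = 0 then 0 else rightPart ω (-(l : ℤ) + m - 1) * pathSum ω n l (m - 1)) := by
  have key : pathSum ω (n + 1) l m = ∑ p : Bool × (Fin n → Bool),
      if numLeft (Fin.snoc p.2 p.1 : Fin (n + 1) → Bool) = l ∧
          numRight (Fin.snoc p.2 p.1 : Fin (n + 1) → Bool) = m then
        pathMatrix ω (n + 1) (Fin.snoc p.2 p.1 : Fin (n + 1) → Bool) else 0 := by
    rw [pathSum, Finset.sum_filter]
    exact ((Fin.snocEquiv (fun _ : Fin (n + 1) => Bool)).sum_comp (fun s =>
      if numLeft s = l ∧ numRight s = m then pathMatrix ω (n + 1) s else 0)).symm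
  rw [key, Fintype.sum_prod_type, Fintype.sum_bool, add_comm]
  simp only [numLeft_snoc, numRight_snoc, pathMatrix, Fin.snoc_last, Fin.init_snoc]
  congr 1
  · rcases l with _ | l
    · simp
    · simp only [pathSum, Finset.mul_sum, Finset.sum_filter]
      simp
      refine Finset.sum_congr rfl fun s _ => ?_
      split_ifs with h
      · rw [endPoint_eq, h.1, h.2]
        congr 2
        ring
      · rfl
  · rcases m with _ | m
    · simp
    · simp only [pathSum, Finset.mul_sum, Finset.sum_filter]
      simp
      refine Finset.sum_congr rfl fun s _ => ?_
      split_ifs with h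
      · rw [endPoint_eq, h.1, h.2]
        congr 2
        ring
      · rfl

lemma normSq_step (ω : ℤ → ℝ) (x : ℤ) (a b : ℂ) :
    ‖coin ω x 0 0 * a + coin ω x 0 1 * b‖ ^ 2 + ‖coin ω x 1 0 * a + coin ω x 1 1 * b‖ ^ 2 =
      ‖a‖ ^ 2 + ‖b‖ ^ 2 := by
  have h2 : Real.sqrt 2 ^ 2 = 2 := Real.sq_sqrt (by norm_num)
  have h0 : ((Real.sqrt 2)⁻¹) ^ 2 = 1 / 2 := by rw [inv_pow, h2]; norm_num
  have e1 : Complex.exp (Complex.I * (ω x : ℂ)) =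
      ⟨Real.cos (ω x), Real.sin (ω x)⟩ := by
    rw [mul_comm]
    apply Complex.ext <;> simp [Complex.exp_ofReal_mul_I_re, Complex.exp_ofReal_mul_I_im]
  have e2 : Complex.exp (-(Complex.I * (ω x : ℂ))) =
      ⟨Real.cos (ω x), -Real.sin (ω x)⟩ := by
    have : -(Complex.I * (ω x : ℂ)) = ((-(ω x) : ℝ) : ℂ) * Complex.I := by push_cast; ring
    rw [this]
    apply Complex.ext
    · rw [Complex.exp_ofReal_mul_I_re, Real.cos_neg]
    · rw [Complex.exp_ofReal_mul_I_im, Real.sin_neg]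
  have hcs := Real.sin_sq_add_cos_sq (ω x)
  simp only [Complex.sq_norm, coin, e1, e2, Complex.normSq_apply]
  simp
  have h1 : Real.sqrt 2 = 2 * (Real.sqrt 2)⁻¹ := by
    have : Real.sqrt 2 ≠ 0 := by positivity
    field_simp
    exact h2
  generalize (Real.sqrt 2)⁻¹ = c at *
  generalize Real.sqrt 2 = d at *
  subst h1
  linear_combination (2 * (a.re ^ 2 + a.im ^ 2 + b.re ^ 2 + b.im ^ 2)) * h0 +
    c ^ 2 * (a.re ^ 2 + a.im ^ 2 + b.re ^ 2 + b.im ^ 2) * hcs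

lemma weight_eq (ω : ℤ → ℝ) (n l m : ℕ) :
    weight ω n l m = ‖(pathSum ω n l m).mulVec initialState 0‖ ^ 2 +
      ‖(pathSum ω n l m).mulVec initialState 1‖ ^ 2 := by
  rw [weight, EuclideanSpace.norm_sq_eq, Fin.sum_univ_two]

lemma weight_nonneg (ω : ℤ → ℝ) (n l m : ℕ) : 0 ≤ weight ω n l m := sq_nonneg _

/-- The total probability is one at every time. -/
lemma sum_weight (ω : ℤ → ℝ) (n : ℕ) :
    ∑ p ∈ Finset.HasAntidiagonal.antidiagonal n, weight ω n p.1 p.2 = 1 := by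
  induction n with
  | zero =>
    have h2 : Real.sqrt 2 ^ 2 = 2 := Real.sq_sqrt (by norm_num)
    have h0 : pathSum ω 0 0 0 = 1 := by simp [pathSum, numLeft, numRight, pathMatrix]
    simp [weight_eq, h0, initialState, h2]
    norm_num
  | succ n ih =>
    set ψ : ℕ → ℕ → Fin 2 → ℂ := fun l m => (pathSum ω n l m).mulVec initialState with hψ
    have hw : ∀ l m, weight ω (n + 1) l m =
        (if l = 0 then 0 else
          ‖(leftPart ω (-(l : ℤ) + m + 1)).mulVec (ψ (l - 1) m) 0‖ ^ 2) +
        (if m = 0 then 0 else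
          ‖(rightPart ω (-(l : ℤ) + m - 1)).mulVec (ψ l (m - 1)) 1‖ ^ 2) := by
      intro l m
      rw [weight_eq, pathSum_succ]
      by_cases hl : l = 0 <;> by_cases hm : m = 0 <;>
        simp only [hl, hm, if_true, if_false, Matrix.add_mulVec, ← Matrix.mulVec_mulVec, hψ,
          Matrix.zero_mulVec, zero_add, add_zero] <;>
        simp [leftPart, rightPart]
    simp only [hw, Finset.sum_add_distrib]
    rw [Finset.Nat.sum_antidiagonal_succ, Finset.Nat.sum_antidiagonal_succ']
    rw [← ih]
    simp only [if_true, zero_add, Nat.add_eq_zero_iff, one_ne_zero, and_false, if_false,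
      Nat.add_sub_cancel]
    rw [← Finset.sum_add_distrib]
    refine Finset.sum_congr rfl fun p _ => ?_
    have e1 : (-((p.1 + 1 : ℕ) : ℤ) + (p.2 : ℤ) + 1) = -(p.1 : ℤ) + p.2 := by push_cast; ring
    have e2 : (-(p.1 : ℤ) + ((p.2 + 1 : ℕ) : ℤ) - 1) = -(p.1 : ℤ) + p.2 := by push_cast; ring
    rw [e1, e2, weight_eq]
    refine Eq.trans ?_ (normSq_step ω (-(p.1 : ℤ) + p.2) (ψ p.1 p.2 0) (ψ p.1 p.2 1))
    simp [leftPart, rightPart, Matrix.mulVec, dotProduct, Fin.sum_univ_two]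

instance (ω : ℤ → ℝ) (n : ℕ) : IsProbabilityMeasure (walkLaw ω n) := by
  constructor
  simp only [walkLaw, Measure.coe_finsetSum, Finset.sum_apply, Measure.smul_apply,
    measure_univ, smul_eq_mul, mul_one]
  rw [← ENNReal.ofReal_sum_of_nonneg (fun p _ => weight_nonneg ω n p.1 p.2), sum_weight,
    ENNReal.ofReal_one]

/-- The quenched law of `X_n / n` on `ℝ`. -/
def scaledLaw (ω : ℤ → ℝ) (n : ℕ) : ProbabilityMeasure ℝ :=
  ⟨(walkLaw ω n).map (fun x : ℤ => (x : ℝ) / (n : ℝ)),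
    Measure.isProbabilityMeasure_map (Measurable.of_discrete).aemeasurable⟩

/-- Konno's density `f_K`. -/
def konnoDensity : ℝ → ℝ :=
  (Set.Ioo (-(1 / Real.sqrt 2)) (1 / Real.sqrt 2)).indicator
    (fun x => 1 / (Real.pi * (1 - x ^ 2) * Real.sqrt (1 - 2 * x ^ 2)))

end

end QWRE

/-! The environment can be gauged away. Multiply the left component at `x` by `exp (-i φ(x))` and
the right component by `exp (-i φ(x - 1))`, where `φ(x - 1) = φ(x) + ω x` and `φ(0) = 0`. Every coin
becomes the Hadamard coin and no modulus changes; the only trace of `ω` is the factor `exp (-i ω 0)`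
on the right component of the initial state (`gaugedLeft_succ`, `gaugedRight_succ`,
`fourierSum_right_zero`).

In Fourier space one step is a matrix `U(k)` with `i U(k) = cos θ + sin θ J`, where `J` is
skew-Hermitian, `J² = -1` and `cos θ = sin k / √2`. Hence `U(k)^n = (-i)^n (cos nθ + sin nθ J)`
(`fourierSum_eq`), without eigenvectors. By Parseval the characteristic function of `X_n / n` at `t`
is the mean over `k` of the inner product of the states at `k` and `k + t/n` (`integral_overlap`).
As `n (θ(k + t/n) - θ(k))` tends to `-t v(k)`, with `v = -θ'` the group velocity, this inner product
converges pointwise and boundedly (`tendsto_overlap`).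

The symmetries `k ↦ -k` and `k ↦ π - k` turn the limit integral into the mean of `(1 - sin (ω 0) v)
exp (i t v)` over `(0, π)`. There `v` pushes the uniform law to `f_K` (`abs_deriv_velocity_mul`), so
Lévy's continuity theorem gives weak convergence. The limit law has no atoms, so interval
probabilities converge too. -/

namespace QWRE

noncomputable section

/-! ### Gauge transformation to the Hadamard walk -/

/-- A potential whose backward difference is the environment. -/
def phase (ω : ℤ → ℝ) (x : ℤ) : ℝ := ∑ j ∈ Finset.Ioc x 0, ω j - ∑ j ∈ Finset.Ioc 0 x, ω j

lemma phase_zero (ω : ℤ → ℝ) : phase ω 0 = 0 := by simp [phase]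

lemma phase_sub_one (ω : ℤ → ℝ) (x : ℤ) : phase ω (x - 1) = phase ω x + ω x := by
  unfold phase
  rcases le_or_gt x 0 with h | h
  · have e1 : Finset.Ioc (x - 1) 0 = insert x (Finset.Ioc x 0) := by
      ext j; simp only [Finset.mem_Ioc, Finset.mem_insert]; omega
    have e2 : Finset.Ioc 0 (x - 1) = ∅ := Finset.Ioc_eq_empty (by omega)
    have e3 : Finset.Ioc 0 x = ∅ := Finset.Ioc_eq_empty (by omega)
    rw [e1, e2, e3, Finset.sum_insert (by simp)]
    simp [add_comm]
  · have e1 : Finset.Ioc 0 x = insert x (Finset.Ioc 0 (x - 1)) := by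
      ext j; simp only [Finset.mem_Ioc, Finset.mem_insert]; omega
    have e2 : Finset.Ioc (x - 1) 0 = ∅ := Finset.Ioc_eq_empty (by omega)
    have e3 : Finset.Ioc x 0 = ∅ := Finset.Ioc_eq_empty (by omega)
    rw [e1, e2, e3, Finset.sum_insert (by simp)]
    simp

/-- The left component of the state at time `n`, in the gauge where every coin is the
Hadamard coin. -/
def gaugedLeft (ω : ℤ → ℝ) (n : ℕ) (p : ℕ × ℕ) : ℂ :=
  Complex.exp (-(Complex.I * (phase ω (-(p.1 : ℤ) + p.2) : ℂ))) *
    (pathSum ω n p.1 p.2).mulVec initialState 0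

/-- The right component of the state at time `n`, in the gauge where every coin is the
Hadamard coin. -/
def gaugedRight (ω : ℤ → ℝ) (n : ℕ) (p : ℕ × ℕ) : ℂ :=
  Complex.exp (-(Complex.I * (phase ω (-(p.1 : ℤ) + p.2 - 1) : ℂ))) *
    (pathSum ω n p.1 p.2).mulVec initialState 1

lemma norm_exp_neg_I_mul (r : ℝ) : ‖Complex.exp (-(Complex.I * (r : ℂ)))‖ = 1 := by
  rw [Complex.norm_exp]; simp

lemma weight_eq_gauged (ω : ℤ → ℝ) (n : ℕ) (p : ℕ × ℕ) :
    weight ω n p.1 p.2 = ‖gaugedLeft ω n p‖ ^ 2 + ‖gaugedRight ω n p‖ ^ 2 := by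
  rw [weight_eq, gaugedLeft, gaugedRight, norm_mul, norm_mul, norm_exp_neg_I_mul,
    norm_exp_neg_I_mul, one_mul, one_mul]

/-- The value `1 / √2` as a complex number. -/
def invSqrtTwo : ℂ := ((1 / Real.sqrt 2 : ℝ) : ℂ)

lemma invSqrtTwo_sq : invSqrtTwo ^ 2 = 1 / 2 := by
  rw [invSqrtTwo, ← Complex.ofReal_pow, div_pow, Real.sq_sqrt (by norm_num)]
  norm_num

lemma leftPart_mul_mulVec (ω : ℤ → ℝ) (x : ℤ) (M : Matrix (Fin 2) (Fin 2) ℂ) (v : Fin 2 → ℂ) :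
    (leftPart ω x * M).mulVec v 0 = invSqrtTwo *
      (Complex.exp (Complex.I * (ω x : ℂ)) * M.mulVec v 0 + M.mulVec v 1) ∧
    (leftPart ω x * M).mulVec v 1 = 0 := by
  rw [← Matrix.mulVec_mulVec]
  generalize M.mulVec v = ψ
  constructor
  · simp [Matrix.mulVec, dotProduct, Fin.sum_univ_two, leftPart, coin, invSqrtTwo]
    ring
  · simp [Matrix.mulVec, dotProduct, Fin.sum_univ_two, leftPart]

lemma rightPart_mul_mulVec (ω : ℤ → ℝ) (x : ℤ) (M : Matrix (Fin 2) (Fin 2) ℂ) (v : Fin 2 → ℂ) :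
    (rightPart ω x * M).mulVec v 0 = 0 ∧
    (rightPart ω x * M).mulVec v 1 = invSqrtTwo *
      (M.mulVec v 0 - Complex.exp (-(Complex.I * (ω x : ℂ))) * M.mulVec v 1) := by
  rw [← Matrix.mulVec_mulVec]
  generalize M.mulVec v = ψ
  constructor
  · simp [Matrix.mulVec, dotProduct, Fin.sum_univ_two, rightPart]
  · simp [Matrix.mulVec, dotProduct, Fin.sum_univ_two, rightPart, coin, invSqrtTwo]
    ring

/-- A path without left steps ends with a right step, which feeds only the right component. This
kills the boundary term when the antidiagonal is reindexed. -/
lemma gaugedLeft_succ_zero (ω : ℤ → ℝ) (n m : ℕ) : gaugedLeft ω (n + 1) (0, m) = 0 := by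
  rw [gaugedLeft, pathSum_succ]
  rw [if_pos rfl, zero_add]
  by_cases h : m = 0
  · simp [h]
  · rw [if_neg h, (rightPart_mul_mulVec _ _ _ _).1, mul_zero]

lemma gaugedRight_succ_zero (ω : ℤ → ℝ) (n l : ℕ) : gaugedRight ω (n + 1) (l, 0) = 0 := by
  rw [gaugedRight, pathSum_succ]
  rw [if_pos rfl, add_zero]
  by_cases h : l = 0
  · simp [h]
  · rw [if_neg h, (leftPart_mul_mulVec _ _ _ _).2, mul_zero]

lemma mulVec_pathSum_succ_left (ω : ℤ → ℝ) (n l m : ℕ) :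
    (pathSum ω (n + 1) (l + 1) m).mulVec initialState 0 = invSqrtTwo *
      (Complex.exp (Complex.I * (ω (-(l : ℤ) + m) : ℂ)) * (pathSum ω n l m).mulVec initialState 0 +
        (pathSum ω n l m).mulVec initialState 1) := by
  have e1 : (-((l + 1 : ℕ) : ℤ) + (m : ℤ) + 1) = -(l : ℤ) + m := by push_cast; ring
  rw [pathSum_succ, if_neg (Nat.succ_ne_zero l), e1, Nat.add_sub_cancel, Matrix.add_mulVec,
    Pi.add_apply]
  have h0 : ((if m = 0 then 0 else
      rightPart ω (-((l + 1 : ℕ) : ℤ) + m - 1) * pathSum ω n (l + 1) (m - 1)).mulVec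
      initialState) 0 = 0 := by
    by_cases h : m = 0
    · simp [h]
    · rw [if_neg h, (rightPart_mul_mulVec _ _ _ _).1]
  rw [h0, add_zero, (leftPart_mul_mulVec _ _ _ _).1]

lemma mulVec_pathSum_succ_right (ω : ℤ → ℝ) (n l m : ℕ) :
    (pathSum ω (n + 1) l (m + 1)).mulVec initialState 1 = invSqrtTwo *
      ((pathSum ω n l m).mulVec initialState 0 -
      Complex.exp (-(Complex.I * (ω (-(l : ℤ) + m) : ℂ))) *
        (pathSum ω n l m).mulVec initialState 1) := by
  have e1 : (-(l : ℤ) + ((m + 1 : ℕ) : ℤ) - 1) = -(l : ℤ) + m := by push_cast; ring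
  rw [pathSum_succ, if_neg (Nat.succ_ne_zero m), e1, Nat.add_sub_cancel, Matrix.add_mulVec,
    Pi.add_apply]
  have h0 : ((if l = 0 then 0 else
      leftPart ω (-(l : ℤ) + ((m + 1 : ℕ) : ℤ) + 1) * pathSum ω n (l - 1) (m + 1)).mulVec
      initialState) 1 = 0 := by
    by_cases h : l = 0
    · simp [h]
    · rw [if_neg h, (leftPart_mul_mulVec _ _ _ _).2]
  rw [h0, zero_add, (rightPart_mul_mulVec _ _ _ _).2]

/-- Arriving at `x - 1` costs the phase `φ(x - 1) = φ(x) + ω x`: its part `ω x` cancels the coin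
entry `exp (i ω x)`, and the full phase is the one already carried by the right component at `x`. -/
lemma gaugedLeft_succ (ω : ℤ → ℝ) (n l m : ℕ) :
    gaugedLeft ω (n + 1) (l + 1, m) =
      invSqrtTwo * (gaugedLeft ω n (l, m) + gaugedRight ω n (l, m)) := by
  have e1 : (-((l + 1 : ℕ) : ℤ) + (m : ℤ)) = -(l : ℤ) + m - 1 := by push_cast; ring
  simp only [gaugedLeft, gaugedRight]
  rw [mulVec_pathSum_succ_left, e1, phase_sub_one, Complex.ofReal_add, mul_add, neg_add,
    Complex.exp_add]
  have h : Complex.exp (-(Complex.I * (ω (-(l : ℤ) + m) : ℂ))) *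
      Complex.exp (Complex.I * (ω (-(l : ℤ) + m) : ℂ)) = 1 := by
    rw [← Complex.exp_add]; simp
  linear_combination (Complex.exp (-(Complex.I * (phase ω (-(l : ℤ) + m) : ℂ))) * invSqrtTwo *
    (pathSum ω n l m).mulVec initialState 0) * h

/-- The right component at `x + 1` carries `φ(x)`, which matches the left component at `x`; the coin
entry `exp (-i ω x)` supplies the missing part of `φ(x - 1)`. -/
lemma gaugedRight_succ (ω : ℤ → ℝ) (n l m : ℕ) :
    gaugedRight ω (n + 1) (l, m + 1) =
      invSqrtTwo * (gaugedLeft ω n (l, m) - gaugedRight ω n (l, m)) := by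
  have e1 : (-(l : ℤ) + ((m + 1 : ℕ) : ℤ) - 1) = -(l : ℤ) + m := by push_cast; ring
  simp only [gaugedLeft, gaugedRight]
  rw [mulVec_pathSum_succ_right, e1, phase_sub_one, Complex.ofReal_add, mul_add, neg_add,
    Complex.exp_add]
  ring

/-! ### Fourier transform of the gauged walk -/

/-- The Fourier series on `ℤ` with the coefficient `a (l, m)` at the frequency `-l + m`, where
`l + m = n`. -/
def fourierSum (n : ℕ) (a : ℕ × ℕ → ℂ) (k : ℝ) : ℂ :=
  ∑ p ∈ Finset.HasAntidiagonal.antidiagonal n,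
    a p * Complex.exp (Complex.I * k * (-(p.1 : ℂ) + p.2))

lemma continuous_fourierSum (n : ℕ) (a : ℕ × ℕ → ℂ) : Continuous (fourierSum n a) := by
  unfold fourierSum
  fun_prop

lemma fourierSum_left_succ (ω : ℤ → ℝ) (n : ℕ) (k : ℝ) :
    fourierSum (n + 1) (gaugedLeft ω (n + 1)) k = invSqrtTwo * Complex.exp (-(Complex.I * k)) *
      (fourierSum n (gaugedLeft ω n) k + fourierSum n (gaugedRight ω n) k) := by
  simp only [fourierSum]
  rw [Finset.Nat.sum_antidiagonal_succ, gaugedLeft_succ_zero, zero_mul, zero_add,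
    ← Finset.sum_add_distrib, Finset.mul_sum]
  refine Finset.sum_congr rfl fun p _ => ?_
  have h : Complex.I * k * (-((p.1 + 1 : ℕ) : ℂ) + p.2) =
      -(Complex.I * k) + Complex.I * k * (-(p.1 : ℂ) + p.2) := by push_cast; ring
  rw [gaugedLeft_succ, h, Complex.exp_add]
  ring

lemma fourierSum_right_succ (ω : ℤ → ℝ) (n : ℕ) (k : ℝ) :
    fourierSum (n + 1) (gaugedRight ω (n + 1)) k = invSqrtTwo * Complex.exp (Complex.I * k) *
      (fourierSum n (gaugedLeft ω n) k - fourierSum n (gaugedRight ω n) k) := by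
  simp only [fourierSum]
  rw [Finset.Nat.sum_antidiagonal_succ', gaugedRight_succ_zero, zero_mul, zero_add,
    ← Finset.sum_sub_distrib, Finset.mul_sum]
  refine Finset.sum_congr rfl fun p _ => ?_
  have h : Complex.I * k * (-(p.1 : ℂ) + ((p.2 + 1 : ℕ) : ℂ)) =
      Complex.I * k + Complex.I * k * (-(p.1 : ℂ) + p.2) := by push_cast; ring
  rw [gaugedRight_succ, h, Complex.exp_add]
  ring

lemma pathSum_zero (ω : ℤ → ℝ) : pathSum ω 0 0 0 = 1 := by
  simp [pathSum, numLeft, numRight, pathMatrix]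

/-- The right component of the initial state in the Hadamard gauge. -/
def gaugedInitialRight (ω : ℤ → ℝ) : ℂ :=
  invSqrtTwo * (Complex.I * Complex.exp (-(Complex.I * (ω 0 : ℂ))))

lemma fourierSum_left_zero (ω : ℤ → ℝ) (k : ℝ) :
    fourierSum 0 (gaugedLeft ω 0) k = invSqrtTwo := by
  simp [fourierSum, gaugedLeft, pathSum_zero, phase_zero, initialState, invSqrtTwo]

/-- The phase at `-1` is `ω 0`; no other value of the environment survives the gauge. -/
lemma fourierSum_right_zero (ω : ℤ → ℝ) (k : ℝ) :
    fourierSum 0 (gaugedRight ω 0) k = gaugedInitialRight ω := by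
  have h := phase_sub_one ω 0
  rw [phase_zero, zero_add, zero_sub] at h
  simp [fourierSum, gaugedRight, pathSum_zero, h, initialState, gaugedInitialRight, invSqrtTwo]
  ring

/-! ### Closed form of the evolution in Fourier space -/

/-- The spectral angle of the Fourier transformed Hadamard walk. -/
def angle (k : ℝ) : ℝ := Real.arccos (Real.sin k / Real.sqrt 2)

/-- The function `√(1 + cos² k)`. -/
def rootFactor (k : ℝ) : ℝ := Real.sqrt (1 + Real.cos k ^ 2)

lemma rootFactor_sq (k : ℝ) : rootFactor k ^ 2 = 1 + Real.cos k ^ 2 :=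
  Real.sq_sqrt (by positivity)

lemma one_le_rootFactor (k : ℝ) : 1 ≤ rootFactor k := by
  rw [rootFactor, Real.one_le_sqrt]
  nlinarith [sq_nonneg (Real.cos k)]

lemma rootFactor_ne_zero (k : ℝ) : rootFactor k ≠ 0 := by linarith [one_le_rootFactor k]

lemma continuous_rootFactor : Continuous rootFactor := by
  unfold rootFactor
  fun_prop

lemma abs_sin_div_sqrt_two_lt_one (k : ℝ) :
    -1 < Real.sin k / Real.sqrt 2 ∧ Real.sin k / Real.sqrt 2 < 1 := by
  have h : 1 < Real.sqrt 2 := by rw [Real.lt_sqrt] <;> norm_num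
  constructor
  · rw [lt_div_iff₀ (by positivity)]; linarith [Real.neg_one_le_sin k]
  · rw [div_lt_iff₀ (by positivity)]; linarith [Real.sin_le_one k]

lemma cos_angle (k : ℝ) : Real.cos (angle k) = Real.sin k / Real.sqrt 2 :=
  Real.cos_arccos (abs_sin_div_sqrt_two_lt_one k).1.le (abs_sin_div_sqrt_two_lt_one k).2.le

lemma one_sub_sin_div_sq (k : ℝ) :
    Real.sqrt (1 - (Real.sin k / Real.sqrt 2) ^ 2) = rootFactor k / Real.sqrt 2 := by
  rw [rootFactor, ← Real.sqrt_div (by positivity)]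
  congr 1
  rw [div_pow, Real.sq_sqrt (by norm_num)]
  linarith [Real.sin_sq_add_cos_sq k]

lemma sin_angle (k : ℝ) : Real.sin (angle k) = rootFactor k / Real.sqrt 2 := by
  rw [angle, Real.sin_arccos, one_sub_sin_div_sq]

/-- The group velocity of the Hadamard walk. -/
def velocity (k : ℝ) : ℝ := Real.cos k / rootFactor k

lemma continuous_velocity : Continuous velocity :=
  Real.continuous_cos.div continuous_rootFactor rootFactor_ne_zero

lemma hasDerivAt_angle (k : ℝ) : HasDerivAt angle (-velocity k) k := by
  have h := (Real.hasDerivAt_arccos (abs_sin_div_sqrt_two_lt_one k).1.ne'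
    (abs_sin_div_sqrt_two_lt_one k).2.ne).comp k ((Real.hasDerivAt_sin k).div_const (Real.sqrt 2))
  convert! h using 1
  rw [one_sub_sin_div_sq, velocity]
  have := rootFactor_ne_zero k
  field_simp

/-- The left component of the normalized generator of the evolution applied to `(a, b)`. -/
def rotatedLeft (a b : ℂ) (k : ℝ) : ℂ :=
  Complex.I * (Real.cos k * a + Complex.exp (-(Complex.I * k)) * b) / rootFactor k

/-- The right component of the normalized generator of the evolution applied to `(a, b)`. -/
def rotatedRight (a b : ℂ) (k : ℝ) : ℂ :=
  Complex.I * (Complex.exp (Complex.I * k) * a - Real.cos k * b) / rootFactor k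

lemma continuous_rotatedLeft (a b : ℂ) : Continuous (rotatedLeft a b) := by
  unfold rotatedLeft
  refine Continuous.div (by fun_prop) (Complex.continuous_ofReal.comp continuous_rootFactor) ?_
  exact fun k => Complex.ofReal_ne_zero.2 (rootFactor_ne_zero k)

lemma continuous_rotatedRight (a b : ℂ) : Continuous (rotatedRight a b) := by
  unfold rotatedRight
  refine Continuous.div (by fun_prop) (Complex.continuous_ofReal.comp continuous_rootFactor) ?_
  exact fun k => Complex.ofReal_ne_zero.2 (rootFactor_ne_zero k)

lemma exp_I_mul_eq (k : ℝ) :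
    Complex.exp (Complex.I * k) = Real.cos k + Complex.I * Real.sin k := by
  rw [mul_comm, Complex.exp_mul_I, Complex.ofReal_cos, Complex.ofReal_sin, mul_comm Complex.I]

lemma exp_neg_I_mul_eq (k : ℝ) :
    Complex.exp (-(Complex.I * k)) = Real.cos k - Complex.I * Real.sin k := by
  have h := exp_I_mul_eq (-k)
  rw [Complex.ofReal_neg, mul_neg] at h
  rw [h, Real.cos_neg, Real.sin_neg, Complex.ofReal_neg]
  ring

lemma ofReal_rootFactor_sq (k : ℝ) : (rootFactor k : ℂ) ^ 2 = 1 + (Real.cos k : ℂ) ^ 2 := by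
  exact_mod_cast rootFactor_sq k

lemma ofReal_sin_sq_add_cos_sq (k : ℝ) : (Real.sin k : ℂ) ^ 2 + (Real.cos k : ℂ) ^ 2 = 1 := by
  exact_mod_cast Real.sin_sq_add_cos_sq k

lemma ofReal_cos_angle (k : ℝ) : (Real.cos (angle k) : ℂ) = invSqrtTwo * Real.sin k := by
  rw [cos_angle, invSqrtTwo]; push_cast; ring

lemma ofReal_sin_angle (k : ℝ) : (Real.sin (angle k) : ℂ) = invSqrtTwo * rootFactor k := by
  rw [sin_angle, invSqrtTwo]; push_cast; ring

/-- The factor `i` makes the determinant of the step matrix equal to `1`; its trace is then `√2 sin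
k = 2 cos (angle k)`. The traceless remainder, divided by `sin (angle k)`, is the operator `J` with
components `rotatedLeft` and `rotatedRight`. -/
lemma evolution_left (a b : ℂ) (k : ℝ) :
    Complex.I * invSqrtTwo * Complex.exp (-(Complex.I * k)) * (a + b) =
      Real.cos (angle k) * a + Real.sin (angle k) * rotatedLeft a b k := by
  have hS : (rootFactor k : ℂ) ≠ 0 := Complex.ofReal_ne_zero.2 (rootFactor_ne_zero k)
  rw [ofReal_cos_angle, ofReal_sin_angle, rotatedLeft, exp_neg_I_mul_eq]
  field_simp
  linear_combination (-(invSqrtTwo * Real.sin k * a)) * Complex.I_sq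

lemma evolution_right (a b : ℂ) (k : ℝ) :
    Complex.I * invSqrtTwo * Complex.exp (Complex.I * k) * (a - b) =
      Real.cos (angle k) * b + Real.sin (angle k) * rotatedRight a b k := by
  have hS : (rootFactor k : ℂ) ≠ 0 := Complex.ofReal_ne_zero.2 (rootFactor_ne_zero k)
  rw [ofReal_cos_angle, ofReal_sin_angle, rotatedRight, exp_I_mul_eq]
  field_simp
  linear_combination (-(invSqrtTwo * Real.sin k * b)) * Complex.I_sq

/-- `J` is `i / rootFactor k` times a traceless Hermitian matrix whose square is `1 + cos² k =
rootFactor k ^ 2`, so `J² = -1`. -/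
lemma rotatedLeft_rotated (a b : ℂ) (k : ℝ) :
    rotatedLeft (rotatedLeft a b k) (rotatedRight a b k) k = -a := by
  have hS : (rootFactor k : ℂ) ≠ 0 := Complex.ofReal_ne_zero.2 (rootFactor_ne_zero k)
  have hS2 := ofReal_rootFactor_sq k
  have hsc := ofReal_sin_sq_add_cos_sq k
  simp only [rotatedLeft, rotatedRight, exp_I_mul_eq, exp_neg_I_mul_eq]
  generalize (Real.cos k : ℂ) = C at *
  generalize (Real.sin k : ℂ) = D at *
  generalize (rootFactor k : ℂ) = S at *
  field_simp
  have hI : Complex.I ^ 2 = -1 := Complex.I_sq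
  have hI4 : Complex.I ^ 4 = 1 := Complex.I_pow_four
  rw [hS2]
  ring_nf
  rw [hI, hI4]
  linear_combination (-a) * hsc

lemma rotatedRight_rotated (a b : ℂ) (k : ℝ) :
    rotatedRight (rotatedLeft a b k) (rotatedRight a b k) k = -b := by
  have hS : (rootFactor k : ℂ) ≠ 0 := Complex.ofReal_ne_zero.2 (rootFactor_ne_zero k)
  have hS2 := ofReal_rootFactor_sq k
  have hsc := ofReal_sin_sq_add_cos_sq k
  simp only [rotatedLeft, rotatedRight, exp_I_mul_eq, exp_neg_I_mul_eq]
  generalize (Real.cos k : ℂ) = C at *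
  generalize (Real.sin k : ℂ) = D at *
  generalize (rootFactor k : ℂ) = S at *
  field_simp
  have hI : Complex.I ^ 2 = -1 := Complex.I_sq
  have hI4 : Complex.I ^ 4 = 1 := Complex.I_pow_four
  rw [hS2]
  ring_nf
  rw [hI, hI4]
  linear_combination (-b) * hsc

/-- The state at time `n` in Fourier space, in closed form. -/
lemma fourierSum_eq (ω : ℤ → ℝ) (k : ℝ) (n : ℕ) :
    fourierSum n (gaugedLeft ω n) k = (-Complex.I) ^ n *
      (Real.cos (n * angle k) * invSqrtTwo +
        Real.sin (n * angle k) * rotatedLeft invSqrtTwo (gaugedInitialRight ω) k) ∧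
    fourierSum n (gaugedRight ω n) k = (-Complex.I) ^ n *
      (Real.cos (n * angle k) * gaugedInitialRight ω +
        Real.sin (n * angle k) * rotatedRight invSqrtTwo (gaugedInitialRight ω) k) := by
  generalize hb : gaugedInitialRight ω = b
  induction n with
  | zero => simp [fourierSum_left_zero, fourierSum_right_zero, hb]
  | succ n ih =>
    have hc : (Real.cos ((n + 1 : ℕ) * angle k) : ℂ) =
        Real.cos (n * angle k) * Real.cos (angle k) -
          Real.sin (n * angle k) * Real.sin (angle k) := by
      push_cast; rw [add_one_mul, Complex.cos_add]
    have hs : (Real.sin ((n + 1 : ℕ) * angle k) : ℂ) =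
        Real.sin (n * angle k) * Real.cos (angle k) +
          Real.cos (n * angle k) * Real.sin (angle k) := by
      push_cast; rw [add_one_mul, Complex.sin_add]
    rw [fourierSum_left_succ, fourierSum_right_succ, ih.1, ih.2, hc, hs, pow_succ]
    set pL := rotatedLeft invSqrtTwo b k with hpL
    set pR := rotatedRight invSqrtTwo b k with hpR
    -- One step is applied to the initial vector and to its image under `J`. As `J² = -1`, their
    -- span is invariant, and the addition formulas advance the angle.
    have h1 := evolution_left invSqrtTwo b k
    have h2 := evolution_right invSqrtTwo b k
    have h3 := evolution_left pL pR k
    have h4 := evolution_right pL pR k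
    rw [hpL, hpR, rotatedLeft_rotated, ← hpL, ← hpR] at h3
    rw [hpL, hpR, rotatedRight_rotated, ← hpL, ← hpR] at h4
    rw [← hpL] at h1
    rw [← hpR] at h2
    generalize Complex.exp (-(Complex.I * k)) = E' at *
    generalize Complex.exp (Complex.I * k) = E at *
    generalize (Real.cos (n * angle k) : ℂ) = c at *
    generalize (Real.sin (n * angle k) : ℂ) = s at *
    generalize (-Complex.I) ^ n = z
    constructor
    · linear_combination (-Complex.I * z * c) * h1 + (-Complex.I * z * s) * h3 +
        (invSqrtTwo * E' * z * (c * (invSqrtTwo + b) + s * (pL + pR))) * Complex.I_sq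
    · linear_combination (-Complex.I * z * c) * h2 + (-Complex.I * z * s) * h4 +
        (invSqrtTwo * E * z * (c * (invSqrtTwo - b) + s * (pL - pR))) * Complex.I_sq

/-! ### Parseval and the characteristic function -/

lemma integral_exp_I_mul_int (j : ℤ) :
    ∫ k in (-Real.pi)..Real.pi, Complex.exp (Complex.I * k * j) =
      if j = 0 then 2 * (Real.pi : ℂ) else 0 := by
  split_ifs with h
  · simp [h]; ring
  · have hj : Complex.I * (j : ℂ) ≠ 0 := mul_ne_zero Complex.I_ne_zero (by exact_mod_cast h)
    have e : ∀ k : ℝ, Complex.exp (Complex.I * k * j) = Complex.exp (Complex.I * j * k) :=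
      fun k => by ring_nf
    simp_rw [e]
    rw [integral_exp_mul_complex hj]
    have e2 : Complex.I * j * (Real.pi : ℂ) =
        Complex.I * j * ((-Real.pi : ℝ) : ℂ) + j * (2 * Real.pi * Complex.I) := by
      push_cast; ring
    rw [e2, Complex.exp_add, Complex.exp_int_mul_two_pi_mul_I, mul_one, sub_self, zero_div]

open ComplexConjugate in
lemma conj_exp_I_mul (r : ℝ) :
    conj (Complex.exp (Complex.I * r)) = Complex.exp (-(Complex.I * r)) := by
  rw [← Complex.exp_conj, map_mul, Complex.conj_I, Complex.conj_ofReal, neg_mul]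

open ComplexConjugate in
/-- Parseval's identity for a Fourier sum and its translate. -/
lemma integral_conj_fourierSum_mul (n : ℕ) (a : ℕ × ℕ → ℂ) (η : ℝ) :
    ∫ k in (-Real.pi)..Real.pi, conj (fourierSum n a k) * fourierSum n a (k + η) =
      2 * Real.pi * ∑ p ∈ Finset.HasAntidiagonal.antidiagonal n,
        ((‖a p‖ ^ 2 : ℝ) : ℂ) * Complex.exp (Complex.I * η * (-(p.1 : ℂ) + p.2)) := by
  have expand : ∀ k : ℝ, conj (fourierSum n a k) * fourierSum n a (k + η) =
      ∑ p ∈ Finset.HasAntidiagonal.antidiagonal n,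
        ∑ q ∈ Finset.HasAntidiagonal.antidiagonal n,
          conj (a p) * a q * Complex.exp (Complex.I * η * (-(q.1 : ℂ) + q.2)) *
            Complex.exp (Complex.I * k *
              (((-(q.1 : ℤ) + q.2) - (-(p.1 : ℤ) + p.2) : ℤ) : ℂ)) := by
    intro k
    simp only [fourierSum]
    rw [map_sum, Finset.sum_mul_sum]
    refine Finset.sum_congr rfl fun p _ => Finset.sum_congr rfl fun q _ => ?_
    have e1 : Complex.I * k * (-(p.1 : ℂ) + p.2) =
        Complex.I * ((k * (-(p.1 : ℝ) + p.2) : ℝ) : ℂ) := by push_cast; ring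
    have e2 : Complex.I * k * (((-(q.1 : ℤ) + q.2) - (-(p.1 : ℤ) + p.2) : ℤ) : ℂ) =
        -(Complex.I * ((k * (-(p.1 : ℝ) + p.2) : ℝ) : ℂ)) +
          Complex.I * k * (-(q.1 : ℂ) + q.2) := by push_cast; ring
    have e3 : Complex.I * ((k + η : ℝ) : ℂ) * (-(q.1 : ℂ) + q.2) =
        Complex.I * k * (-(q.1 : ℂ) + q.2) + Complex.I * η * (-(q.1 : ℂ) + q.2) := by
      push_cast; ring
    rw [map_mul, e1, conj_exp_I_mul, e2, e3, Complex.exp_add, Complex.exp_add]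
    ring
  simp_rw [expand]
  rw [intervalIntegral.integral_finsetSum]
  · rw [Finset.mul_sum]
    refine Finset.sum_congr rfl fun p hp => ?_
    rw [intervalIntegral.integral_finsetSum]
    · simp_rw [intervalIntegral.integral_const_mul, integral_exp_I_mul_int]
      rw [Finset.sum_eq_single p]
      · rw [sub_self, if_pos rfl, Complex.ofReal_pow, ← Complex.conj_mul']
        ring
      · intro q hq hqp
        rw [if_neg, mul_zero]
        -- Since `l + m = n` is fixed, the position `-l + m` determines the pair, so distinct pairs
        -- have distinct frequencies.
        intro h
        apply hqp
        rw [Finset.HasAntidiagonal.mem_antidiagonal] at hp hq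
        ext <;> omega
      · exact fun h => absurd hp h
    · exact fun q _ => Continuous.intervalIntegrable (by fun_prop) _ _
  · exact fun p _ => Continuous.intervalIntegrable (by fun_prop) _ _

lemma charFun_scaledLaw (ω : ℤ → ℝ) (n : ℕ) (t : ℝ) :
    charFun (scaledLaw ω n : Measure ℝ) t =
      ∑ p ∈ Finset.HasAntidiagonal.antidiagonal n,
        (weight ω n p.1 p.2 : ℂ) *
          Complex.exp (Complex.I * (t / n : ℝ) * (-(p.1 : ℂ) + p.2)) := by
  rw [charFun_apply_real]
  change ∫ x, _ ∂((walkLaw ω n).map (fun x : ℤ => (x : ℝ) / (n : ℝ))) = _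
  rw [integral_map Measurable.of_discrete.aemeasurable (by fun_prop), walkLaw,
    integral_finsetSum_measure]
  · refine Finset.sum_congr rfl fun p _ => ?_
    rw [integral_smul_measure, integral_dirac, ENNReal.toReal_ofReal (weight_nonneg _ _ _ _),
      Complex.real_smul]
    congr 2
    push_cast
    ring
  · exact fun p _ => (integrable_dirac (by simp)).smul_measure (by simp)

open ComplexConjugate in
/-- The inner product of the Fourier transformed state at `k` with the one at `k + η`. -/
def overlap (ω : ℤ → ℝ) (n : ℕ) (η k : ℝ) : ℂ :=
  conj (fourierSum n (gaugedLeft ω n) k) * fourierSum n (gaugedLeft ω n) (k + η) +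
    conj (fourierSum n (gaugedRight ω n) k) * fourierSum n (gaugedRight ω n) (k + η)

lemma continuous_overlap (ω : ℤ → ℝ) (n : ℕ) (η : ℝ) : Continuous (overlap ω n η) := by
  have hL := continuous_fourierSum n (gaugedLeft ω n)
  have hR := continuous_fourierSum n (gaugedRight ω n)
  unfold overlap
  fun_prop

lemma integral_overlap (ω : ℤ → ℝ) (n : ℕ) (t : ℝ) :
    ∫ k in (-Real.pi)..Real.pi, overlap ω n (t / n) k =
      2 * Real.pi * charFun (scaledLaw ω n : Measure ℝ) t := by
  have hL := continuous_fourierSum n (gaugedLeft ω n)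
  have hR := continuous_fourierSum n (gaugedRight ω n)
  unfold overlap
  rw [intervalIntegral.integral_add (Continuous.intervalIntegrable (by fun_prop) _ _)
    (Continuous.intervalIntegrable (by fun_prop) _ _), integral_conj_fourierSum_mul,
    integral_conj_fourierSum_mul, charFun_scaledLaw, ← mul_add, ← Finset.sum_add_distrib]
  congr 1
  refine Finset.sum_congr rfl fun p _ => ?_
  rw [weight_eq_gauged]
  push_cast
  ring

/-! ### Pointwise limit and bound of the overlap -/

open ComplexConjugate in
lemma conj_exp_neg_I_mul (r : ℝ) :
    conj (Complex.exp (-(Complex.I * r))) = Complex.exp (Complex.I * r) := by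
  rw [← conj_exp_I_mul, Complex.conj_conj]

open ComplexConjugate in
lemma conj_rotatedLeft (a b : ℂ) (k : ℝ) : conj (rotatedLeft a b k) =
    -Complex.I * (Real.cos k * conj a + Complex.exp (Complex.I * k) * conj b) / rootFactor k := by
  rw [rotatedLeft, map_div₀, map_mul, map_add, map_mul, map_mul, Complex.conj_I,
    Complex.conj_ofReal, Complex.conj_ofReal, conj_exp_neg_I_mul]

open ComplexConjugate in
lemma conj_rotatedRight (a b : ℂ) (k : ℝ) : conj (rotatedRight a b k) =
    -Complex.I * (Complex.exp (-(Complex.I * k)) * conj a - Real.cos k * conj b) /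
      rootFactor k := by
  rw [rotatedRight, map_div₀, map_mul, map_sub, map_mul, map_mul, Complex.conj_I,
    Complex.conj_ofReal, Complex.conj_ofReal, conj_exp_I_mul]

open ComplexConjugate in
lemma conj_rotated_mul_rotated (a b : ℂ) (k : ℝ) :
    conj (rotatedLeft a b k) * rotatedLeft a b k +
      conj (rotatedRight a b k) * rotatedRight a b k = conj a * a + conj b * b := by
  have hS : (rootFactor k : ℂ) ≠ 0 := Complex.ofReal_ne_zero.2 (rootFactor_ne_zero k)
  have hS2 := ofReal_rootFactor_sq k
  have hsc := ofReal_sin_sq_add_cos_sq k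
  rw [conj_rotatedLeft, conj_rotatedRight, rotatedLeft, rotatedRight, exp_I_mul_eq,
    exp_neg_I_mul_eq]
  generalize (Real.cos k : ℂ) = C at *
  generalize (Real.sin k : ℂ) = D at *
  generalize (rootFactor k : ℂ) = S at *
  field_simp
  rw [hS2]
  have hI : Complex.I ^ 2 = -1 := Complex.I_sq
  have hI4 : Complex.I ^ 4 = 1 := Complex.I_pow_four
  ring_nf
  simp only [hI, hI4]
  linear_combination (conj a * a + conj b * b) * hsc

open ComplexConjugate in
lemma conj_rotated_mul (a b : ℂ) (k : ℝ) :
    conj (rotatedLeft a b k) * a + conj (rotatedRight a b k) * b =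
      -(conj a * rotatedLeft a b k + conj b * rotatedRight a b k) := by
  rw [conj_rotatedLeft, conj_rotatedRight, rotatedLeft, rotatedRight]
  ring

-- Both initial components have squared modulus `1/2`, so the diagonal terms of `J` cancel. The
-- cross terms combine to the real part of `i exp (-i (ω 0 + k))`, which is `sin (ω 0 + k)`.
open ComplexConjugate in
lemma conj_mul_rotated (ω : ℤ → ℝ) (k : ℝ) :
    conj invSqrtTwo * rotatedLeft invSqrtTwo (gaugedInitialRight ω) k +
      conj (gaugedInitialRight ω) * rotatedRight invSqrtTwo (gaugedInitialRight ω) k =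
      Complex.I * (Real.sin (ω 0 + k) / rootFactor k : ℝ) := by
  have h : conj invSqrtTwo = invSqrtTwo := Complex.conj_ofReal _
  have hS : (rootFactor k : ℂ) ≠ 0 := Complex.ofReal_ne_zero.2 (rootFactor_ne_zero k)
  have hsc := ofReal_sin_sq_add_cos_sq (ω 0)
  rw [rotatedLeft, rotatedRight, gaugedInitialRight]
  simp only [map_mul, conj_exp_neg_I_mul, h, Complex.conj_I]
  rw [exp_I_mul_eq, exp_neg_I_mul_eq, exp_I_mul_eq, exp_neg_I_mul_eq, Real.sin_add]
  push_cast
  simp only [Complex.ofReal_sin, Complex.ofReal_cos] at hsc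
  generalize (rootFactor k : ℂ) = S at *
  generalize Complex.cos k = C at *
  generalize Complex.sin k = D at *
  generalize Complex.cos (ω 0) = C0 at *
  generalize Complex.sin (ω 0) = D0 at *
  field_simp
  rw [invSqrtTwo_sq]
  have hI : Complex.I ^ 2 = -1 := Complex.I_sq
  have hI4 : Complex.I ^ 4 = 1 := Complex.I_pow_four
  ring_nf
  simp only [hI, hI4]
  linear_combination (-C / 2) * hsc

lemma tendsto_mul_angle_sub (k t : ℝ) :
    Tendsto (fun n : ℕ => n * angle (k + t / n) - n * angle k) atTop (𝓝 (-(t * velocity k))) := by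
  -- Differentiating in `x = 1/n` rather than in `t/n` also covers `t = 0`.
  have h1 : HasDerivAt (fun x : ℝ => angle (k + t * x)) (-velocity k * (t * 1)) 0 := by
    have h2 : HasDerivAt (fun x : ℝ => k + t * x) (t * 1) 0 :=
      ((hasDerivAt_id (0 : ℝ)).const_mul t).const_add k
    refine HasDerivAt.comp (h₂ := angle) (h := fun x : ℝ => k + t * x) 0 ?_ h2
    simpa using hasDerivAt_angle k
  have h3 := (hasDerivAt_iff_tendsto_slope_zero.1 h1).comp
    ((tendsto_inv_atTop_nhdsGT_zero.mono_right (nhdsGT_le_nhdsNE 0)).comp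
      (tendsto_natCast_atTop_atTop (R := ℝ)))
  convert! h3 using 2 with n
  · simp [div_eq_mul_inv, mul_sub]
  · ring

-- The fast angles enter the main terms only through their difference, so no stationary phase
-- argument is needed: the remaining oscillating factors are bounded and multiply differences that
-- vanish by continuity of `J` in `k`.
open ComplexConjugate in
lemma tendsto_overlap (ω : ℤ → ℝ) (t k : ℝ) :
    Tendsto (fun n : ℕ => overlap ω n (t / n) k) atTop
      (𝓝 (Real.cos (t * velocity k) -
        Complex.I * (Real.sin (ω 0 + k) / rootFactor k : ℝ) * Real.sin (t * velocity k))) := by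
  have hq := conj_mul_rotated ω k
  generalize Complex.I * ((Real.sin (ω 0 + k) / rootFactor k : ℝ) : ℂ) = q at hq ⊢
  have hN : conj invSqrtTwo * invSqrtTwo +
      conj (gaugedInitialRight ω) * gaugedInitialRight ω = 1 := by
    have h : conj invSqrtTwo = invSqrtTwo := Complex.conj_ofReal _
    have h2 : Complex.exp (Complex.I * (ω 0)) * Complex.exp (-(Complex.I * (ω 0))) = 1 := by
      rw [← Complex.exp_add]; simp
    simp only [gaugedInitialRight, map_mul, conj_exp_neg_I_mul, h, Complex.conj_I]
    linear_combination 2 * invSqrtTwo_sq - Complex.I ^ 2 * invSqrtTwo ^ 2 * h2 -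
      invSqrtTwo ^ 2 * Complex.I_sq
  have hpp := (conj_rotated_mul_rotated invSqrtTwo (gaugedInitialRight ω) k).trans hN
  have hpa := conj_rotated_mul invSqrtTwo (gaugedInitialRight ω) k
  rw [hq] at hpa
  have hL := continuous_rotatedLeft invSqrtTwo (gaugedInitialRight ω)
  have hR := continuous_rotatedRight invSqrtTwo (gaugedInitialRight ω)
  have hstate := fourierSum_eq ω
  set a := invSqrtTwo
  set b := gaugedInitialRight ω
  set pL := rotatedLeft a b
  set pR := rotatedRight a b
  have hk : Tendsto (fun n : ℕ => k + t / n) atTop (𝓝 k) := by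
    simpa using (tendsto_const_div_atTop_nhds_zero_nat t).const_add k
  have hL' : Tendsto (fun n : ℕ => pL (k + t / n)) atTop (𝓝 (pL k)) := (hL.tendsto k).comp hk
  have hR' : Tendsto (fun n : ℕ => pR (k + t / n)) atTop (𝓝 (pR k)) := (hR.tendsto k).comp hk
  -- With `J(k + t/n)` replaced by `J(k)`, unitarity and skewness of `J` give the first two terms
  -- through the subtraction formulas; the last two are the errors of that replacement.
  have key : ∀ n : ℕ, overlap ω n (t / n) k =
      Real.cos (n * angle (k + t / n) - n * angle k) +
        q * Real.sin (n * angle (k + t / n) - n * angle k) +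
      ((Real.sin (n * angle k) * Real.sin (n * angle (k + t / n)) : ℝ) : ℂ) *
        (conj (pL k) * pL (k + t / n) + conj (pR k) * pR (k + t / n) - 1) +
      ((Real.cos (n * angle k) * Real.sin (n * angle (k + t / n)) : ℝ) : ℂ) *
        (conj a * pL (k + t / n) + conj b * pR (k + t / n) - q) := by
    intro n
    have hz : conj ((-Complex.I) ^ n) * (-Complex.I) ^ n = 1 := by
      rw [map_pow, ← mul_pow]; simp
    rw [overlap, (hstate k n).1, (hstate k n).2, (hstate (k + t / n) n).1,
      (hstate (k + t / n) n).2, Real.cos_sub, Real.sin_sub]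
    simp only [map_mul, map_add, Complex.conj_ofReal]
    simp only [Complex.ofReal_mul, Complex.ofReal_add, Complex.ofReal_sub]
    generalize conj ((-Complex.I) ^ n) = z' at *
    generalize (-Complex.I) ^ n = z at *
    generalize (Real.cos (n * angle k) : ℂ) = c
    generalize (Real.sin (n * angle k) : ℂ) = s
    generalize (Real.cos (n * angle (k + t / n)) : ℂ) = c'
    generalize (Real.sin (n * angle (k + t / n)) : ℂ) = s'
    linear_combination ((c * conj a + s * conj (pL k)) * (c' * a + s' * pL (k + t / n)) +
      (c * conj b + s * conj (pR k)) * (c' * b + s' * pR (k + t / n))) * hz +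
      c * c' * hN + s * c' * hpa
  simp_rw [key]
  have hbdd : ∀ (u : ℕ → ℝ) (w : ℕ → ℂ), (∀ n, |u n| ≤ 1) → Tendsto w atTop (𝓝 0) →
      Tendsto (fun n => (u n : ℂ) * w n) atTop (𝓝 0) := by
    intro u w hu hw
    refine squeeze_zero_norm (fun n => ?_) (tendsto_zero_iff_norm_tendsto_zero.1 hw)
    rw [norm_mul, Complex.norm_real, Real.norm_eq_abs]
    exact mul_le_of_le_one_left (norm_nonneg _) (hu n)
  have hmul : ∀ x y : ℝ, |x| ≤ 1 → |y| ≤ 1 → |x * y| ≤ 1 := fun x y hx hy => by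
    rw [abs_mul]; exact mul_le_one₀ hx (abs_nonneg _) hy
  have h1 : Tendsto (fun n : ℕ =>
      ((Real.sin (n * angle k) * Real.sin (n * angle (k + t / n)) : ℝ) : ℂ) *
        (conj (pL k) * pL (k + t / n) + conj (pR k) * pR (k + t / n) - 1)) atTop (𝓝 0) := by
    refine hbdd _ _ (fun n => hmul _ _ (Real.abs_sin_le_one _) (Real.abs_sin_le_one _)) ?_
    have := ((hL'.const_mul (conj (pL k))).add (hR'.const_mul (conj (pR k)))).sub_const 1
    rwa [hpp, sub_self] at this
  have h2 : Tendsto (fun n : ℕ =>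
      ((Real.cos (n * angle k) * Real.sin (n * angle (k + t / n)) : ℝ) : ℂ) *
        (conj a * pL (k + t / n) + conj b * pR (k + t / n) - q)) atTop (𝓝 0) := by
    refine hbdd _ _ (fun n => hmul _ _ (Real.abs_cos_le_one _) (Real.abs_sin_le_one _)) ?_
    have := ((hL'.const_mul (conj a)).add (hR'.const_mul (conj b))).sub_const q
    rwa [hq, sub_self] at this
  have hcos := (Complex.continuous_ofReal.tendsto _).comp
    ((Real.continuous_cos.tendsto _).comp (tendsto_mul_angle_sub k t))
  have hsin := ((Complex.continuous_ofReal.tendsto _).comp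
    ((Real.continuous_sin.tendsto _).comp (tendsto_mul_angle_sub k t))).const_mul q
  have := ((hcos.add hsin).add h1).add h2
  rw [Real.cos_neg, Real.sin_neg, Complex.ofReal_neg, mul_neg, ← sub_eq_add_neg, add_zero,
    add_zero] at this
  exact this

lemma norm_rotatedLeft_le (a b : ℂ) (k : ℝ) : ‖rotatedLeft a b k‖ ≤ ‖a‖ + ‖b‖ := by
  rw [rotatedLeft, norm_div, norm_mul, Complex.norm_I, one_mul, Complex.norm_real,
    Real.norm_of_nonneg (by linarith [one_le_rootFactor k])]
  refine (div_le_self (norm_nonneg _) (one_le_rootFactor k)).trans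
    ((norm_add_le _ _).trans (add_le_add ?_ ?_))
  · rw [norm_mul, Complex.norm_real]
    exact mul_le_of_le_one_left (norm_nonneg _) (Real.abs_cos_le_one k)
  · rw [norm_mul, norm_exp_neg_I_mul, one_mul]

lemma norm_rotatedRight_le (a b : ℂ) (k : ℝ) : ‖rotatedRight a b k‖ ≤ ‖a‖ + ‖b‖ := by
  rw [rotatedRight, norm_div, norm_mul, Complex.norm_I, one_mul, Complex.norm_real,
    Real.norm_of_nonneg (by linarith [one_le_rootFactor k])]
  refine (div_le_self (norm_nonneg _) (one_le_rootFactor k)).trans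
    ((norm_sub_le _ _).trans (add_le_add ?_ ?_))
  · rw [norm_mul, mul_comm Complex.I, Complex.norm_exp_ofReal_mul_I, one_mul]
  · rw [norm_mul, Complex.norm_real]
    exact mul_le_of_le_one_left (norm_nonneg _) (Real.abs_cos_le_one k)

/-- The closed form has bounded coefficients and `rootFactor` is at least `1`; the constant serves
as the dominating function. -/
lemma exists_norm_overlap_le (ω : ℤ → ℝ) : ∃ B : ℝ, ∀ (n : ℕ) (η k : ℝ),
    ‖overlap ω n η k‖ ≤ B := by
  set a := invSqrtTwo
  set b := gaugedInitialRight ω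
  have hcomb : ∀ (n : ℕ) (x M : ℝ) (u w : ℂ), ‖u‖ ≤ M → ‖w‖ ≤ M →
      ‖(-Complex.I) ^ n * (Real.cos x * u + Real.sin x * w)‖ ≤ M + M := by
    intro n x M u w hu hw
    rw [norm_mul, norm_pow, norm_neg, Complex.norm_I, one_pow, one_mul]
    refine (norm_add_le _ _).trans (add_le_add ?_ ?_)
    · rw [norm_mul, Complex.norm_real]
      exact (mul_le_of_le_one_left (norm_nonneg _) (Real.abs_cos_le_one x)).trans hu
    · rw [norm_mul, Complex.norm_real]
      exact (mul_le_of_le_one_left (norm_nonneg _) (Real.abs_sin_le_one x)).trans hw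
  set M := ‖a‖ + ‖b‖
  have hM : 0 ≤ M := by positivity
  have hL : ∀ n k, ‖fourierSum n (gaugedLeft ω n) k‖ ≤ M + M := fun n k => by
    rw [(fourierSum_eq ω k n).1]
    exact hcomb _ _ _ _ _ (le_add_of_nonneg_right (norm_nonneg _)) (norm_rotatedLeft_le _ _ _)
  have hR : ∀ n k, ‖fourierSum n (gaugedRight ω n) k‖ ≤ M + M := fun n k => by
    rw [(fourierSum_eq ω k n).2]
    exact hcomb _ _ _ _ _ (le_add_of_nonneg_left (norm_nonneg _)) (norm_rotatedRight_le _ _ _)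
  refine ⟨(M + M) * (M + M) + (M + M) * (M + M), fun n η k => ?_⟩
  refine (norm_add_le _ _).trans (add_le_add ?_ ?_)
  · rw [norm_mul, RCLike.norm_conj]
    exact mul_le_mul (hL _ _) (hL _ _) (norm_nonneg _) (by positivity)
  · rw [norm_mul, RCLike.norm_conj]
    exact mul_le_mul (hR _ _) (hR _ _) (norm_nonneg _) (by positivity)

lemma tendsto_charFun_scaledLaw (ω : ℤ → ℝ) (t : ℝ) :
    Tendsto (fun n : ℕ => 2 * Real.pi * charFun (scaledLaw ω n : Measure ℝ) t) atTop
      (𝓝 (∫ k in (-Real.pi)..Real.pi, ((Real.cos (t * velocity k) -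
        Complex.I * (Real.sin (ω 0 + k) / rootFactor k : ℝ) * Real.sin (t * velocity k) : ℂ)))) := by
  obtain ⟨B, hB⟩ := exists_norm_overlap_le ω
  simp_rw [← integral_overlap]
  refine intervalIntegral.tendsto_integral_filter_of_dominated_convergence (fun _ => B) ?_ ?_ ?_ ?_
  · exact Eventually.of_forall fun n => (continuous_overlap ω n _).aestronglyMeasurable
  · exact Eventually.of_forall fun n => Eventually.of_forall fun k _ => hB _ _ _
  · exact intervalIntegrable_const
  · exact Eventually.of_forall fun k _ => tendsto_overlap ω t k

/-! ### Group velocity and Konno's density -/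

lemma hasDerivAt_velocity (k : ℝ) :
    HasDerivAt velocity (-(Real.sin k / rootFactor k ^ 3)) k := by
  have hpos : 1 + Real.cos k ^ 2 ≠ 0 := by positivity
  have h1 : HasDerivAt rootFactor (-(Real.cos k * Real.sin k / rootFactor k)) k := by
    have h := (((Real.hasDerivAt_cos k).pow 2).const_add 1).sqrt hpos
    convert! h using 1
    simp only [Pi.pow_apply, rootFactor]
    field_simp
    simp
    ring
  have h2 := (Real.hasDerivAt_cos k).div h1 (rootFactor_ne_zero k)
  convert! h2 using 1
  have hS := rootFactor_ne_zero k
  field_simp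
  linear_combination Real.sin k * rootFactor_sq k

lemma velocity_neg (k : ℝ) : velocity (-k) = velocity k := by
  simp [velocity, rootFactor]

lemma velocity_pi_sub (k : ℝ) : velocity (Real.pi - k) = -velocity k := by
  simp [velocity, rootFactor, Real.cos_pi_sub, neg_div]

lemma velocity_zero : velocity 0 = 1 / Real.sqrt 2 := by
  norm_num [velocity, rootFactor]

lemma velocity_pi : velocity Real.pi = -(1 / Real.sqrt 2) := by
  rw [← velocity_zero, ← velocity_pi_sub, sub_zero]

lemma rootFactor_pos (k : ℝ) : 0 < rootFactor k := zero_lt_one.trans_le (one_le_rootFactor k)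

lemma strictAntiOn_velocity : StrictAntiOn velocity (Set.Icc 0 Real.pi) := by
  refine strictAntiOn_of_deriv_neg (convex_Icc 0 Real.pi) continuous_velocity.continuousOn ?_
  intro k hk
  rw [interior_Icc] at hk
  rw [(hasDerivAt_velocity k).deriv, neg_lt_zero]
  exact div_pos (Real.sin_pos_of_mem_Ioo hk) (pow_pos (rootFactor_pos k) 3)

lemma velocity_image : velocity '' Set.Ioo 0 Real.pi =
    Set.Ioo (-(1 / Real.sqrt 2)) (1 / Real.sqrt 2) := by
  rw [← velocity_pi, ← velocity_zero]
  apply Set.Subset.antisymm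
  · rintro _ ⟨k, hk, rfl⟩
    have h0 : (0 : ℝ) ∈ Set.Icc 0 Real.pi := Set.left_mem_Icc.2 Real.pi_pos.le
    have h1 : Real.pi ∈ Set.Icc 0 Real.pi := Set.right_mem_Icc.2 Real.pi_pos.le
    have h2 := Set.Ioo_subset_Icc_self hk
    exact ⟨strictAntiOn_velocity h2 h1 hk.2, strictAntiOn_velocity h0 h2 hk.1⟩
  · exact intermediate_value_Ioo' Real.pi_pos.le continuous_velocity.continuousOn

/-- With `S = rootFactor k`, one has `1 - v² = 1/S²` and `√(1 - 2v²) = sin k / S`, so the density at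
`v` is `S³ / (π sin k)`, cancelling the Jacobian. -/
lemma abs_deriv_velocity_mul (k : ℝ) (hk : k ∈ Set.Ioo 0 Real.pi) :
    |-(Real.sin k / rootFactor k ^ 3)| * konnoDensity (velocity k) = 1 / Real.pi := by
  have hs := Real.sin_pos_of_mem_Ioo hk
  have hS := rootFactor_pos k
  have hmem : velocity k ∈ Set.Ioo (-(1 / Real.sqrt 2)) (1 / Real.sqrt 2) :=
    velocity_image ▸ Set.mem_image_of_mem _ hk
  have h1 : 1 - velocity k ^ 2 = 1 / rootFactor k ^ 2 := by
    rw [velocity]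
    field_simp
    linear_combination rootFactor_sq k
  have h2 : 1 - 2 * velocity k ^ 2 = (Real.sin k / rootFactor k) ^ 2 := by
    rw [velocity]
    field_simp
    linear_combination rootFactor_sq k - Real.sin_sq_add_cos_sq k
  rw [konnoDensity, Set.indicator_of_mem hmem, h1, h2, Real.sqrt_sq (by positivity), abs_neg,
    abs_of_nonneg (by positivity)]
  field_simp

variable {E : Type*} [NormedAddCommGroup E] [NormedSpace ℝ E]

lemma konnoDensity_smul_eq_indicator (G : ℝ → E) :
    (fun y => konnoDensity y • G y) =
      (velocity '' Set.Ioo 0 Real.pi).indicator (fun y => konnoDensity y • G y) := by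
  rw [eq_comm, Set.indicator_eq_self, velocity_image]
  intro y hy
  by_contra h
  exact hy (by simp only [konnoDensity, Set.indicator_of_notMem h, zero_smul])

lemma injOn_velocity : Set.InjOn velocity (Set.Ioo 0 Real.pi) :=
  strictAntiOn_velocity.injOn.mono Set.Ioo_subset_Icc_self

lemma measurableSet_velocity_image : MeasurableSet (velocity '' Set.Ioo 0 Real.pi) :=
  velocity_image ▸ measurableSet_Ioo

lemma abs_deriv_velocity_smul (G : ℝ → E) : Set.EqOn
    (fun k => |-(Real.sin k / rootFactor k ^ 3)| • konnoDensity (velocity k) • G (velocity k))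
    (fun k => (1 / Real.pi) • G (velocity k)) (Set.Ioo 0 Real.pi) := fun k hk => by
  simp only [smul_smul, abs_deriv_velocity_mul k hk]

/-- The density `konnoDensity` is that of the group velocity at a uniform momentum. -/
lemma integral_konnoDensity_smul (G : ℝ → E) :
    ∫ y, konnoDensity y • G y = (1 / Real.pi) • ∫ k in (0)..Real.pi, G (velocity k) := by
  rw [konnoDensity_smul_eq_indicator, integral_indicator measurableSet_velocity_image,
    integral_image_eq_integral_abs_deriv_smul measurableSet_Ioo
      (fun k _ => (hasDerivAt_velocity k).hasDerivWithinAt) injOn_velocity,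
    setIntegral_congr_fun measurableSet_Ioo (abs_deriv_velocity_smul G), integral_smul,
    intervalIntegral.integral_of_le Real.pi_pos.le, integral_Ioc_eq_integral_Ioo]

/-- The density is singular at `±1/√2`, but the change of variables by `velocity` turns the
integrand into a continuous function on a compact interval. -/
lemma integrable_konnoDensity_smul {G : ℝ → E} (hG : Continuous G) :
    Integrable (fun y => konnoDensity y • G y) := by
  rw [konnoDensity_smul_eq_indicator, integrable_indicator_iff measurableSet_velocity_image,
    integrableOn_image_iff_integrableOn_abs_deriv_smul measurableSet_Ioo
      (fun k _ => (hasDerivAt_velocity k).hasDerivWithinAt) injOn_velocity,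
    integrableOn_congr_fun (abs_deriv_velocity_smul G) measurableSet_Ioo]
  refine IntegrableOn.mono_set ?_ (Set.Ioo_subset_Icc_self (a := 0) (b := Real.pi))
  exact ((hG.comp continuous_velocity).const_smul (1 / Real.pi)).integrableOn_Icc

/-- The reflection `k ↦ π - k` reverses the velocity. -/
lemma integral_comp_velocity_of_odd {G : ℝ → E} (hG : ∀ y, G (-y) = -G y) :
    ∫ k in (0)..Real.pi, G (velocity k) = 0 := by
  have h := intervalIntegral.integral_comp_sub_left (a := 0) (b := Real.pi)
    (fun k => G (velocity k)) Real.pi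
  simp only [velocity_pi_sub, hG, intervalIntegral.integral_neg, sub_self, sub_zero] at h
  have h2 : (2 : ℝ) • ∫ k in (0)..Real.pi, G (velocity k) = 0 := by
    rw [two_smul]
    exact add_eq_zero_iff_neg_eq.2 h
  exact (smul_eq_zero.1 h2).resolve_left two_ne_zero

/-! ### The limit law and its characteristic function -/

/-- The limit density. -/
def limitDensity (s x : ℝ) : ℝ := (1 - s * x) * konnoDensity x

lemma limitDensity_nonneg {s : ℝ} (hs : |s| ≤ 1) (x : ℝ) : 0 ≤ limitDensity s x := by
  unfold limitDensity konnoDensity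
  by_cases h : x ∈ Set.Ioo (-(1 / Real.sqrt 2)) (1 / Real.sqrt 2)
  · rw [Set.indicator_of_mem h]
    have hr : 1 / Real.sqrt 2 ≤ 1 := by
      rw [div_le_one (by positivity), Real.one_le_sqrt]; norm_num
    have hx : |x| ≤ 1 := abs_le.2 ⟨by linarith [h.1], by linarith [h.2]⟩
    have hsx : |s * x| ≤ 1 := by
      rw [abs_mul]; exact mul_le_one₀ hs (abs_nonneg _) hx
    have hx2 : x ^ 2 ≤ 1 := (sq_le_one_iff_abs_le_one x).2 hx
    have h1 : 0 ≤ 1 - x ^ 2 := by linarith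
    have h2 : 0 ≤ 1 - s * x := by linarith [(abs_le.1 hsx).2]
    have := Real.pi_pos
    positivity
  · rw [Set.indicator_of_notMem h, mul_zero]

lemma limitDensity_smul (s : ℝ) (G : ℝ → E) :
    (fun x => limitDensity s x • G x) = fun x => konnoDensity x • ((1 - s * x) • G x) := by
  funext x
  rw [limitDensity, smul_smul, mul_comm]

lemma limitDensity_eq (s : ℝ) :
    limitDensity s = fun x => konnoDensity x • (1 - s * x) := by
  funext x
  rw [limitDensity, smul_eq_mul, mul_comm]

lemma integrable_limitDensity (s : ℝ) : Integrable (limitDensity s) := by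
  rw [limitDensity_eq]
  exact integrable_konnoDensity_smul (by fun_prop)

lemma measurable_limitDensity (s : ℝ) : Measurable (limitDensity s) := by
  unfold limitDensity konnoDensity
  exact (by fun_prop : Measurable fun x : ℝ => 1 - s * x).mul
    (Measurable.indicator (by fun_prop) measurableSet_Ioo)

lemma integral_limitDensity (s : ℝ) : ∫ x, limitDensity s x = 1 := by
  have hv : IntervalIntegrable (fun k => s * velocity k) volume 0 Real.pi :=
    (continuous_velocity.const_mul s).intervalIntegrable _ _
  have hodd : ∫ k in (0)..Real.pi, s * velocity k = 0 :=
    integral_comp_velocity_of_odd (G := fun y => s * y) (fun y => by ring)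
  rw [limitDensity_eq, integral_konnoDensity_smul (fun x => 1 - s * x),
    intervalIntegral.integral_sub intervalIntegrable_const hv, hodd]
  have := Real.pi_ne_zero
  simp [this]

/-- The limit law. -/
def limitMeasure (s : ℝ) : Measure ℝ :=
  volume.withDensity (fun x => ENNReal.ofReal (limitDensity s x))

lemma limitMeasure_apply {s : ℝ} (hs : |s| ≤ 1) {A : Set ℝ} (hA : MeasurableSet A) :
    limitMeasure s A = ENNReal.ofReal (∫ x in A, limitDensity s x) := by
  rw [limitMeasure, withDensity_apply _ hA, ofReal_integral_eq_lintegral_ofReal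
    (integrable_limitDensity s).integrableOn
    (Eventually.of_forall fun x => limitDensity_nonneg hs x)]

lemma isProbabilityMeasure_limitMeasure {s : ℝ} (hs : |s| ≤ 1) :
    IsProbabilityMeasure (limitMeasure s) := by
  constructor
  rw [limitMeasure_apply hs MeasurableSet.univ, Measure.restrict_univ, integral_limitDensity,
    ENNReal.ofReal_one]

lemma charFun_limitMeasure {s : ℝ} (hs : |s| ≤ 1) (t : ℝ) :
    charFun (limitMeasure s) t = (1 / Real.pi) • ∫ k in (0)..Real.pi,
      (1 - s * velocity k) • Complex.exp (t * velocity k * Complex.I) := by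
  rw [charFun_apply_real, limitMeasure, integral_withDensity_eq_integral_toReal_smul
    (measurable_limitDensity s).ennreal_ofReal (Eventually.of_forall fun _ => ENNReal.ofReal_lt_top)]
  simp_rw [ENNReal.toReal_ofReal (limitDensity_nonneg hs _)]
  rw [limitDensity_smul, integral_konnoDensity_smul]

/-- Folding `k` with `-k` keeps the velocity and replaces `sin (w + k)` by its part `sin w cos k`.
The two sides then differ by a function odd in the velocity, which integrates to zero. -/
lemma integral_overlap_limit (w t : ℝ) :
    ∫ k in (-Real.pi)..Real.pi, ((Real.cos (t * velocity k) -
      Complex.I * (Real.sin (w + k) / rootFactor k : ℝ) * Real.sin (t * velocity k) : ℂ)) =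
    2 * ∫ k in (0)..Real.pi,
      (1 - Real.sin w * velocity k) • Complex.exp (t * velocity k * Complex.I) := by
  have hv := continuous_velocity
  have hS := continuous_rootFactor
  set H : ℝ → ℂ := fun k => Real.cos (t * velocity k) -
    Complex.I * (Real.sin (w + k) / rootFactor k : ℝ) * Real.sin (t * velocity k) with hH
  have hq : Continuous fun k => Real.sin (w + k) / rootFactor k :=
    Continuous.div (by fun_prop) hS rootFactor_ne_zero
  have hHc : Continuous H := by
    refine Continuous.sub (by fun_prop) (Continuous.mul ?_ (by fun_prop))
    exact continuous_const.mul (Complex.continuous_ofReal.comp hq)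
  -- These are the terms of `2 (1 - sin w · v) exp (i t v)` absent from the folded integrand.
  have hodd : ∫ k in (0)..Real.pi, 2 * (Complex.I * Real.sin (t * velocity k) -
      Real.sin w * velocity k * Real.cos (t * velocity k) : ℂ) = 0 := by
    refine integral_comp_velocity_of_odd (G := fun y : ℝ => 2 * (Complex.I * Real.sin (t * y) -
      Real.sin w * y * Real.cos (t * y) : ℂ)) fun y => ?_
    rw [mul_neg, Real.sin_neg, Real.cos_neg]
    push_cast
    ring
  have hneg : ∫ k in (-Real.pi)..0, H k = ∫ k in (0)..Real.pi, H (-k) := by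
    rw [intervalIntegral.integral_comp_neg, neg_zero]
  have hHn : Continuous fun k => H (-k) := hHc.comp continuous_neg
  have hHs : Continuous fun k => H (-k) + H k := hHn.add hHc
  rw [← intervalIntegral.integral_add_adjacent_intervals (hHc.intervalIntegrable (-Real.pi) 0)
    (hHc.intervalIntegrable 0 Real.pi), hneg, ← intervalIntegral.integral_add
    (hHn.intervalIntegrable _ _) (hHc.intervalIntegrable _ _),
    ← add_zero (∫ k in (0)..Real.pi, (H (-k) + H k)), ← hodd, ← intervalIntegral.integral_add
    (hHs.intervalIntegrable _ _)
    (Continuous.intervalIntegrable (by fun_prop) _ _), ← intervalIntegral.integral_const_mul]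
  refine intervalIntegral.integral_congr fun k _ => ?_
  have e1 : Complex.exp (t * velocity k * Complex.I) =
      Real.cos (t * velocity k) + Real.sin (t * velocity k) * Complex.I := by
    rw [Complex.exp_mul_I]; push_cast; rfl
  have e2 : rootFactor (-k) = rootFactor k := by simp [rootFactor]
  have e3 : Real.sin (w + -k) / rootFactor k + Real.sin (w + k) / rootFactor k =
      2 * Real.sin w * velocity k := by
    rw [velocity, Real.sin_add, Real.sin_add, Real.sin_neg, Real.cos_neg]
    ring
  have e4 : ((Real.sin (w + -k) / rootFactor k : ℝ) : ℂ) +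
      ((Real.sin (w + k) / rootFactor k : ℝ) : ℂ) = 2 * (Real.sin w : ℂ) * (velocity k : ℂ) := by
    exact_mod_cast e3
  have e5 : ((1 - Real.sin w * velocity k : ℝ) : ℂ) = 1 - Real.sin w * velocity k := by
    simp
  simp only [hH, velocity_neg, e1, e2, Complex.real_smul, e5]
  linear_combination (-Complex.I * Real.sin (t * velocity k)) * e4

lemma tendsto_charFun_limitMeasure (ω : ℤ → ℝ) (t : ℝ) :
    Tendsto (fun n : ℕ => charFun (scaledLaw ω n : Measure ℝ) t) atTop
      (𝓝 (charFun (limitMeasure (Real.sin (ω 0))) t)) := by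
  have hpi : (2 * Real.pi : ℂ) ≠ 0 := by simp [Real.pi_ne_zero]
  have h := (tendsto_charFun_scaledLaw ω t).const_mul (2 * Real.pi : ℂ)⁻¹
  simp_rw [inv_mul_cancel_left₀ hpi] at h
  convert! h using 2
  rw [charFun_limitMeasure (Real.abs_sin_le_one _), integral_overlap_limit, Complex.real_smul]
  generalize (∫ k in (0)..Real.pi, _ : ℂ) = J
  push_cast
  field_simp

end

end QWRE

/-! ### Weak convergence and interval probabilities -/

theorem theorem2 (ω : ℤ → ℝ) :
    (∃ μ : ProbabilityMeasure ℝ,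
      (μ : Measure ℝ) = volume.withDensity
        (fun x : ℝ => ENNReal.ofReal ((1 - Real.sin (ω 0) * x) * QWRE.konnoDensity x)) ∧
      Tendsto (fun n : ℕ => QWRE.scaledLaw ω n) atTop (𝓝 μ)) ∧
    ∀ u v : ℝ, u ≤ v →
      Tendsto
        (fun n : ℕ => (QWRE.walkLaw ω n).real {x : ℤ | u ≤ (x : ℝ) / n ∧ (x : ℝ) / n ≤ v})
        atTop
        (𝓝 (∫ x in u..v, (1 - Real.sin (ω 0) * x) * QWRE.konnoDensity x)) := by
  have hs := Real.abs_sin_le_one (ω 0)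
  let μ : ProbabilityMeasure ℝ :=
    ⟨QWRE.limitMeasure (Real.sin (ω 0)), QWRE.isProbabilityMeasure_limitMeasure hs⟩
  have hμ : (μ : Measure ℝ) = QWRE.limitMeasure (Real.sin (ω 0)) := rfl
  have hlim : Tendsto (fun n : ℕ => QWRE.scaledLaw ω n) atTop (𝓝 μ) :=
    ProbabilityMeasure.tendsto_of_tendsto_charFun (QWRE.tendsto_charFun_limitMeasure ω)
  refine ⟨⟨μ, rfl, hlim⟩, fun u v huv => ?_⟩
  have hac : (μ : Measure ℝ) ≪ volume := withDensity_absolutelyContinuous _ _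
  -- The frontier is the pair of endpoints, null under an absolutely continuous law, so the
  -- portmanteau theorem applies to the closed interval.
  have hfr : (μ : Measure ℝ) (frontier (Set.Icc u v)) = 0 := by
    rw [frontier_Icc huv]
    exact hac ((Set.toFinite _).measure_zero _)
  have h := ProbabilityMeasure.tendsto_measure_of_null_frontier_of_tendsto' hlim hfr
  have h' := (ENNReal.tendsto_toReal (measure_ne_top _ _)).comp h
  have e1 : ((μ : Measure ℝ) (Set.Icc u v)).toReal =
      ∫ x in u..v, (1 - Real.sin (ω 0) * x) * QWRE.konnoDensity x := by
    rw [hμ, QWRE.limitMeasure_apply hs measurableSet_Icc, ENNReal.toReal_ofReal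
      (integral_nonneg fun x => QWRE.limitDensity_nonneg hs x), integral_Icc_eq_integral_Ioc,
      intervalIntegral.integral_of_le huv]
    rfl
  rw [e1] at h'
  refine h'.congr fun n => ?_
  change ((QWRE.walkLaw ω n).map (fun x : ℤ => (x : ℝ) / (n : ℝ)) (Set.Icc u v)).toReal = _
  rw [Measure.map_apply Measurable.of_discrete measurableSet_Icc]
  rfl
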